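/- Consider $n$ items that arrive in the order $1,\dots,n$, with independent values $X_i\sim\mathcal D_i$, where each $\mathcal D_i$ is a probability distribution on $[0,\infty)$, and a downward-closed family $\mathcal F$ of subsets of $[n]$ with $\emptyset\in\mathcal F$ (the feasible sets). Let $r=\max_{S\in\mathcal F}|S|$. In the problem Downward-Closed Prophet, a deterministic algorithm receives $n$, $\mathcal F$ and $\mathcal D_1,\dots,\mathcal D_n$ in advance. It then observes $X_1,\dots,X_n$ one at a time and, upon observing $X_i$, must decide immediately and irrevocably whether to add $i$ to its set $W$ (initially empty), where $W$ must always remain in $\mathcal F$. Thus its decision on $i$ is a (measurable) function of $X_1,\dots,X_i$. There are an absolute constant $C>0$ and a deterministic algorithm for Downward-Closed Prophet such that, for all $n$, $\mathcal F$ and $\mathcal D_1,\dots,\mathcal D_n$ as above, the final set $W$ satisfies $$\mathbb E\Big[\max_{S\in\mathcal F}\sum_{i\in S}X_i\Big]\;\le\; C\,\log(n+1)\,\log(r+1)\;\mathbb E\Big[\sum_{i\in W}X_i\Big],$$ where the expectations may be infinite. In particular, the competitive ratio is $O(\log n\cdot\log r)$ for $n\ge r\ge 2$. -/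

import Mathlib

open MeasureTheory
open scoped NNReal ENNReal

/-- An instance of Downward-Closed Prophet with `n` items, indexed in their order of arrival:
a downward-closed family of feasible sets (containing the empty set), and for each item the
distribution of its non-negative value. The values are independent. -/
structure ProphetInstance (n : ℕ) where
  feasible : Finset (Finset (Fin n))
  empty_mem : ∅ ∈ feasible
  downwardClosed : IsLowerSet (feasible : Set (Finset (Fin n)))
  dist : Fin n → ProbabilityMeasure ℝ≥0

namespace ProphetInstance

variable {n : ℕ} (I : ProphetInstance n)

/-- The maximum cardinality of a feasible set. -/
def rank : ℕ := I.feasible.sup Finset.card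

/-- The joint law of the values: the product of the distributions (independence). -/
noncomputable def law : Measure (Fin n → ℝ≥0) :=
  Measure.pi fun i => (I.dist i : Measure ℝ≥0)

/-- The offline optimum `max_{S ∈ F} ∑_{i ∈ S} x i` on the realization `x`. -/
noncomputable def offlineValue (x : Fin n → ℝ≥0) : ℝ≥0 :=
  I.feasible.sup fun S => ∑ i ∈ S, x i

/-- The expected offline optimum (possibly infinite). -/
noncomputable def opt : ℝ≥0∞ := ∫⁻ x, (I.offlineValue x : ℝ≥0∞) ∂I.law

/-- A deterministic online policy for the instance `I`: `select x` is the final set `W` on the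
realization `x`. The decision on item `i` depends only on the values of the items up to `i`, and
is a measurable function of them. Since the family is downward-closed, feasibility of the
final set means that `W` is feasible at all times. -/
structure OnlinePolicy where
  select : (Fin n → ℝ≥0) → Finset (Fin n)
  online : ∀ (i : Fin n) (x y : Fin n → ℝ≥0),
    (∀ j, j ≤ i → x j = y j) → (i ∈ select x ↔ i ∈ select y)
  measurable : ∀ i : Fin n, MeasurableSet {x | i ∈ select x}
  feasible : ∀ x, select x ∈ I.feasible

/-- The expected total value of the items that the policy selects. -/
noncomputable def OnlinePolicy.value {I : ProphetInstance n} (P : I.OnlinePolicy) : ℝ≥0∞ :=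
  ∫⁻ x, ((∑ i ∈ P.select x, x i : ℝ≥0) : ℝ≥0∞) ∂I.law

end ProphetInstance

/-- A deterministic algorithm for Downward-Closed Prophet: on input `n`, the feasible sets and
the distributions, it fixes a deterministic online policy. -/
def ProphetAlgorithm : Type :=
  (n : ℕ) → (I : ProphetInstance n) → I.OnlinePolicy

/-- The algorithm has competitive ratio at most `ρ n r` on every instance with `n` items whose
largest feasible set has `r` elements. -/
def ProphetAlgorithm.HasCompetitiveRatio (A : ProphetAlgorithm) (ρ : ℕ → ℕ → ℝ) : Prop :=
  ∀ (n : ℕ) (I : ProphetInstance n), I.opt ≤ ENNReal.ofReal (ρ n I.rank) * (A n I).value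

/-! The algorithm is the optimal online policy given by backward induction; let `J` be its value.
The offline optimum is compared with `J` by cutting the values at `T = 2J` and at the dyadic levels
`T / 2 ^ j` below it.

Values above `T`: accepting the first large singleton shows that with probability at least 1/2 there
is none, so their total expectation is at most `2J` (`expectedLarge_le`). Values below `T / r`: at
most `r` of them are used, so they cost at most `T`. About `log r` levels remain.

At a level `s`, each item is either active (value at least `s`) or not, and the largest feasible
number of active items must be compared with what an online policy can collect. The expectation of 2
to that number is at most `potential`, a weighted count of feasible extensions, and the logarithm of
`potential` is at most `log n + 2` times the optimal online count, plus 2 (`log_potential_le`). By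
Jensen the same bound holds for `log 2` times the expected offline count. Since the online count
times `s` is at most `J`, each level costs `O(log n) * J + O(s)`, and the errors `s` sum to `O(T)`.
-/

namespace ProphetInstance

/-! ### Backward induction and the optimal policy. -/

/-- The largest expected value that an online policy can still collect when it holds the set `W`
and the items in the list are yet to arrive. -/
noncomputable def dp {n : ℕ} (I : ProphetInstance n) :
    List (Fin n) → Finset (Fin n) → ℝ≥0∞
  | [], _ => 0
  | i :: l, W => ∫⁻ y, (if insert i W ∈ I.feasible then
      max (dp I l W) ((y : ℝ≥0∞) + dp I l (insert i W)) else dp I l W) ∂(I.dist i : Measure ℝ≥0)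

/-- The set held after processing item `i` with value `y`, when the items in `l` are to follow:
the item is added whenever this is feasible and optimal. -/
noncomputable def step {n : ℕ} (I : ProphetInstance n) (i : Fin n) (l : List (Fin n))
    (W : Finset (Fin n)) (y : ℝ≥0) : Finset (Fin n) :=
  open Classical in
  if insert i W ∈ I.feasible ∧ I.dp l W ≤ (y : ℝ≥0∞) + I.dp l (insert i W)
    then insert i W else W

/-- The final set of the optimal policy that starts from `W` and processes the list of items. -/
noncomputable def run {n : ℕ} (I : ProphetInstance n) :
    List (Fin n) → Finset (Fin n) → (Fin n → ℝ≥0) → Finset (Fin n)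
  | [], W, _ => W
  | i :: l, W, x => run I l (I.step i l W (x i)) x

variable {n : ℕ} (I : ProphetInstance n)

lemma step_mem_feasible {i : Fin n} {l : List (Fin n)} {W : Finset (Fin n)}
    (hW : W ∈ I.feasible) (y : ℝ≥0) : I.step i l W y ∈ I.feasible := by
  unfold step
  split_ifs with h
  exacts [h.1, hW]

lemma mem_step_iff_of_ne {i j : Fin n} (hij : j ≠ i) (l : List (Fin n)) (W : Finset (Fin n))
    (y : ℝ≥0) : j ∈ I.step i l W y ↔ j ∈ W := by
  unfold step
  split_ifs with h
  · simp [hij]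
  · rfl

lemma run_mem_feasible (x : Fin n → ℝ≥0) (l : List (Fin n)) :
    ∀ W ∈ I.feasible, I.run l W x ∈ I.feasible := by
  induction l with
  | nil => exact fun W hW => hW
  | cons i l ih => exact fun W hW => ih _ (I.step_mem_feasible hW _)

lemma mem_run_iff_of_notMem {j : Fin n} (x : Fin n → ℝ≥0) (l : List (Fin n)) :
    ∀ W, j ∉ l → (j ∈ I.run l W x ↔ j ∈ W) := by
  induction l with
  | nil => exact fun W _ => Iff.rfl
  | cons i l ih =>
    intro W hj
    rw [List.mem_cons, not_or] at hj
    rw [run, ih _ hj.2, mem_step_iff_of_ne I hj.1]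

lemma mem_run_congr {j : Fin n} {x y : Fin n → ℝ≥0} (hxy : ∀ k, k ≤ j → x k = y k)
    (l : List (Fin n)) (hl : l.Pairwise (· < ·)) :
    ∀ W, j ∈ I.run l W x ↔ j ∈ I.run l W y := by
  induction l with
  | nil => exact fun W => Iff.rfl
  | cons i l ih =>
    intro W
    rw [List.pairwise_cons] at hl
    rw [run, run]
    rcases le_or_gt i j with hij | hij
    · rw [hxy i hij]
      exact ih hl.2 _
    -- Items after `j` cannot change whether `j` is held, so the values that may differ do not
    -- matter.
    · have hj : j ∉ l := fun h => (hl.1 j h).not_gt hij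
      rw [mem_run_iff_of_notMem I _ _ _ hj, mem_run_iff_of_notMem I _ _ _ hj,
        mem_step_iff_of_ne I hij.ne, mem_step_iff_of_ne I hij.ne]

lemma measurableSet_mem_run (j : Fin n) (l : List (Fin n)) :
    ∀ W, MeasurableSet {x | j ∈ I.run l W x} := by
  classical
  induction l with
  | nil => exact fun W => MeasurableSet.const (j ∈ W)
  | cons i l ih =>
    intro W
    have hc : MeasurableSet {x : Fin n → ℝ≥0 | insert i W ∈ I.feasible ∧
        I.dp l W ≤ (x i : ℝ≥0∞) + I.dp l (insert i W)} :=
      (MeasurableSet.const _).inter (measurableSet_le measurable_const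
        ((measurable_pi_apply i).coe_nnreal_ennreal.add_const _))
    convert hc.ite (ih (insert i W)) (ih W) using 1
    ext x
    by_cases h : insert i W ∈ I.feasible ∧ I.dp l W ≤ (x i : ℝ≥0∞) + I.dp l (insert i W)
    · simp [run, step, Set.ite, h]
    · simp only [run, step, Set.ite]
      simp [h]

/-- The policy that follows the dynamic program `dp`. -/
noncomputable def optimalPolicy : I.OnlinePolicy where
  select := I.run (List.finRange n) ∅
  online _ _ _ h := I.mem_run_congr h _ (List.pairwise_lt_finRange n) ∅
  measurable j := I.measurableSet_mem_run j _ ∅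
  feasible x := I.run_mem_feasible x _ ∅ I.empty_mem

lemma measurable_sum_run (l : List (Fin n)) (W : Finset (Fin n)) :
    Measurable fun x : Fin n → ℝ≥0 => ((∑ j ∈ I.run l W x, x j : ℝ≥0) : ℝ≥0∞) := by
  classical
  have h : (fun x : Fin n → ℝ≥0 => ((∑ j ∈ I.run l W x, x j : ℝ≥0) : ℝ≥0∞)) =
      fun x => ((∑ j, if j ∈ I.run l W x then x j else 0 : ℝ≥0) : ℝ≥0∞) := by
    ext x
    rw [← Finset.sum_filter, Finset.filter_mem_eq_inter, Finset.univ_inter]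
  rw [h]
  refine (Finset.measurable_sum _ fun j _ => ?_).coe_nnreal_ennreal
  exact Measurable.ite (I.measurableSet_mem_run j l W) (measurable_pi_apply j) measurable_const

/-- The distributions of the values, as plain measures. -/
noncomputable abbrev marg (i : Fin n) : Measure ℝ≥0 := (I.dist i : Measure ℝ≥0)

/-- A coordinate that is not integrated out may be treated as a constant. -/
lemma lmarginal_apply_of_notMem {i : Fin n} {s : Finset (Fin n)} (hi : i ∉ s)
    (f : ℝ≥0 → (Fin n → ℝ≥0) → ℝ≥0∞) (x : Fin n → ℝ≥0) :
    (∫⋯∫⁻_s, (fun z => f (z i) z) ∂I.marg) x = (∫⋯∫⁻_s, f (x i) ∂I.marg) x := by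
  simp only [lmarginal, Function.updateFinset, hi, dite_false]

/-- Integrating only over the items still to come keeps the values already collected as constants,
which lets the induction run over arbitrary states `W`. -/
lemma lmarginal_sum_run (l : List (Fin n)) (hl : l.Nodup) :
    ∀ (W : Finset (Fin n)) (x : Fin n → ℝ≥0), (∀ i ∈ l, i ∉ W) →
      (∫⋯∫⁻_l.toFinset, (fun z => ((∑ j ∈ I.run l W z, z j : ℝ≥0) : ℝ≥0∞)) ∂I.marg) x =
        ((∑ j ∈ W, x j : ℝ≥0) : ℝ≥0∞) + I.dp l W := by
  induction l with
  | nil => intro W x _; simp [run, dp]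
  | cons i l ih =>
    intro W x hW
    rw [List.nodup_cons] at hl
    have hi : i ∉ l.toFinset := by simpa using hl.1
    have hiW : i ∉ W := hW i (by simp)
    rw [List.toFinset_cons, lmarginal_insert _ (I.measurable_sum_run _ _) hi]
    have key : ∀ y : ℝ≥0, (∫⋯∫⁻_l.toFinset,
        (fun z => ((∑ j ∈ I.run (i :: l) W z, z j : ℝ≥0) : ℝ≥0∞)) ∂I.marg)
          (Function.update x i y) =
        ((∑ j ∈ W, x j : ℝ≥0) : ℝ≥0∞) + (if insert i W ∈ I.feasible then
          max (I.dp l W) ((y : ℝ≥0∞) + I.dp l (insert i W)) else I.dp l W) := by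
      intro y
      have hsum : ∑ j ∈ W, Function.update x i y j = ∑ j ∈ W, x j :=
        Finset.sum_congr rfl fun j hj => Function.update_of_ne (ne_of_mem_of_not_mem hj hiW) _ _
      simp only [run]
      rw [I.lmarginal_apply_of_notMem hi
        (fun t z => ((∑ j ∈ I.run l (I.step i l W t) z, z j : ℝ≥0) : ℝ≥0∞)),
        Function.update_self, ih hl.2]
      · unfold step
        by_cases h1 : insert i W ∈ I.feasible
        · by_cases h2 : I.dp l W ≤ (y : ℝ≥0∞) + I.dp l (insert i W)
          · rw [if_pos ⟨h1, h2⟩, if_pos h1, max_eq_right h2, Finset.sum_insert hiW, hsum,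
              Function.update_self, ENNReal.coe_add]
            ring
          · rw [if_neg (fun h => h2 h.2), if_pos h1, max_eq_left (not_le.1 h2).le, hsum]
        · rw [if_neg (fun h => h1 h.1), if_neg h1, hsum]
      · intro j hj
        have hji : j ≠ i := fun h => hl.1 (h ▸ hj)
        rw [mem_step_iff_of_ne I hji]
        exact hW j (by simp [hj])
    simp only [key]
    rw [lintegral_add_left measurable_const, lintegral_const, dp]
    simp

lemma value_optimalPolicy : I.optimalPolicy.value = I.dp (List.finRange n) ∅ := by
  have h := I.lmarginal_sum_run (List.finRange n) (List.nodup_finRange n) ∅ 0 (by simp)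
  rw [List.toFinset_finRange, ← lintegral_eq_lmarginal_univ] at h
  simpa [OnlinePolicy.value, law, optimalPolicy] using h

lemma le_dp_cons (i : Fin n) (l : List (Fin n)) (W : Finset (Fin n)) :
    I.dp l W ≤ I.dp (i :: l) W := by
  have h : I.dp l W = ∫⁻ _, I.dp l W ∂I.marg i := by simp
  rw [h, dp]
  refine lintegral_mono fun y => ?_
  split_ifs
  exacts [le_max_left _ _, le_rfl]

/-- The dynamic program does at least as well as accepting an item exactly if its value lies
in `A`. -/
lemma accept_le_dp_cons {i : Fin n} {l : List (Fin n)} {W : Finset (Fin n)}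
    (h : insert i W ∈ I.feasible) {A : Set ℝ≥0} (hA : MeasurableSet A) :
    I.marg i Aᶜ * I.dp l W + ∫⁻ y in A, ((y : ℝ≥0∞) + I.dp l (insert i W)) ∂I.marg i
      ≤ I.dp (i :: l) W := by
  rw [dp, add_comm]
  refine le_trans ?_ (lintegral_add_compl _ hA).le
  refine add_le_add (lintegral_mono fun y => ?_) ?_
  · rw [if_pos h]; exact le_max_right _ _
  · rw [mul_comm, ← setLIntegral_const]
    refine lintegral_mono fun y => ?_
    rw [if_pos h]; exact le_max_left _ _

end ProphetInstance

/-! ### A single level: offline versus online counts of active items. -/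

namespace ProphetInstance

/-- The probability that the value of item `i` is at least `s`. -/
noncomputable def activeProb {n : ℕ} (I : ProphetInstance n) (s : ℝ≥0) (i : Fin n) : ℝ :=
  (I.marg i).real (Set.Ici s)

/-- An upper bound for the exponential moment of the number of items of value at least `s` by
which the set `W` can be extended, when the items in the list are yet to arrive. -/
noncomputable def potential {n : ℕ} (I : ProphetInstance n) (s : ℝ≥0) :
    List (Fin n) → Finset (Fin n) → ℝ
  | [], _ => 1
  | i :: l, W => potential I s l W + if insert i W ∈ I.feasible then
      2 * I.activeProb s i * potential I s l (insert i W) else 0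

/-- The largest expected number of items of value at least `s` that an online policy can still
collect when it holds the set `W` and the items in the list are yet to arrive. -/
noncomputable def countDp {n : ℕ} (I : ProphetInstance n) (s : ℝ≥0) :
    List (Fin n) → Finset (Fin n) → ℝ
  | [], _ => 0
  | i :: l, W => if insert i W ∈ I.feasible then
      (1 - I.activeProb s i) * countDp I s l W +
        I.activeProb s i * max (countDp I s l W) (1 + countDp I s l (insert i W))
      else countDp I s l W

/-- The largest number of items from the list of value at least `s` by which the set `W` can be
extended. -/
noncomputable def maxCount {n : ℕ} (I : ProphetInstance n) (s : ℝ≥0) :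
    List (Fin n) → Finset (Fin n) → (Fin n → ℝ≥0) → ℕ
  | [], _, _ => 0
  | i :: l, W, x => open Classical in if s ≤ x i ∧ insert i W ∈ I.feasible then
      max (maxCount I s l W x) (1 + maxCount I s l (insert i W) x) else maxCount I s l W x

variable {n : ℕ} (I : ProphetInstance n) (s : ℝ≥0)

lemma activeProb_nonneg (i : Fin n) : 0 ≤ I.activeProb s i := measureReal_nonneg

lemma activeProb_le_one (i : Fin n) : I.activeProb s i ≤ 1 := measureReal_le_one

lemma marg_Ici (i : Fin n) : I.marg i (Set.Ici s) = ENNReal.ofReal (I.activeProb s i) := by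
  simp [activeProb]

lemma marg_compl_Ici (i : Fin n) :
    I.marg i (Set.Ici s)ᶜ = ENNReal.ofReal (1 - I.activeProb s i) := by
  rw [activeProb, ← probReal_compl_eq_one_sub measurableSet_Ici]
  simp

lemma mem_feasible_of_subset {S T : Finset (Fin n)} (hT : T ∈ I.feasible) (h : S ⊆ T) :
    S ∈ I.feasible :=
  I.downwardClosed h hT

lemma one_le_potential (l : List (Fin n)) : ∀ W, 1 ≤ I.potential s l W := by
  induction l with
  | nil => exact fun W => le_rfl
  | cons i l ih =>
    intro W
    rw [potential]
    have := I.activeProb_nonneg s i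
    have h1 := ih (insert i W)
    split_ifs
    · nlinarith [ih W, mul_nonneg this (zero_le_one.trans h1)]
    · linarith [ih W]

lemma potential_pos (l : List (Fin n)) (W : Finset (Fin n)) : 0 < I.potential s l W :=
  zero_lt_one.trans_le (I.one_le_potential s l W)

lemma potential_anti (l : List (Fin n)) :
    ∀ {W W' : Finset (Fin n)}, W ⊆ W' → I.potential s l W' ≤ I.potential s l W := by
  induction l with
  | nil => exact fun _ => le_rfl
  | cons i l ih =>
    intro W W' h
    have hi : insert i W ⊆ insert i W' := Finset.insert_subset_insert i h
    have hp := I.activeProb_nonneg s i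
    rw [potential, potential]
    refine add_le_add (ih h) ?_
    by_cases h' : insert i W' ∈ I.feasible
    · rw [if_pos h', if_pos (I.mem_feasible_of_subset h' hi)]
      exact mul_le_mul_of_nonneg_left (ih hi) (by positivity)
    · rw [if_neg h']
      have := I.potential_pos s l (insert i W)
      split_ifs <;> positivity

lemma countDp_nonneg (l : List (Fin n)) : ∀ W, 0 ≤ I.countDp s l W := by
  induction l with
  | nil => exact fun W => le_rfl
  | cons i l ih =>
    intro W
    have h0 := I.activeProb_nonneg s i
    have h1 := I.activeProb_le_one s i
    have h2 := ih W
    rw [countDp]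
    split_ifs
    · exact add_nonneg (mul_nonneg (by linarith) h2)
        (mul_nonneg h0 (h2.trans (le_max_left _ _)))
    · exact h2

/-- With `a`, `b` the potentials after rejecting and after accepting, item `i` raises the
log-potential by at most `2 * p * (b / a)`. If `b / a ≤ 1 / N`, accepting would destroy almost all
extensions; the raise is at most `2 / N` and goes into the additive error. Otherwise accepting
lowers the log-potential by at most `log N`, so the one item gained pays for this loss and for the
raise, at a price of `log N + 2`. -/
lemma log_potential_le {N : ℝ} (hN : 1 ≤ N) (l : List (Fin n)) : ∀ W,
    Real.log (I.potential s l W) ≤ (Real.log N + 2) * I.countDp s l W + 2 * l.length / N := by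
  induction l with
  | nil => intro W; simp [potential, countDp]
  | cons i l ih =>
    intro W
    have hN0 : 0 < N := zero_lt_one.trans_le hN
    have hK : 0 ≤ Real.log N + 2 := by linarith [Real.log_nonneg hN]
    have hlen : 2 * ((i :: l).length : ℝ) / N = 2 * l.length / N + 2 / N := by
      rw [List.length_cons]; push_cast; ring
    have hdiv : 0 ≤ 2 / N := by positivity
    rw [hlen, potential, countDp]
    split_ifs with h
    · set p := I.activeProb s i
      have hp0 : 0 ≤ p := I.activeProb_nonneg s i
      have hp1 : p ≤ 1 := I.activeProb_le_one s i
      set a := I.potential s l W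
      set b := I.potential s l (insert i W)
      have ha : 0 < a := I.potential_pos s l W
      have hb : 0 < b := I.potential_pos s l _
      have hba : b ≤ a := I.potential_anti s l (Finset.subset_insert i W)
      have hlog : Real.log (a + 2 * p * b) ≤ Real.log a + 2 * p * (b / a) := by
        have h1 : a + 2 * p * b = a * (1 + 2 * p * (b / a)) := by field_simp
        have h2 : 0 < 1 + 2 * p * (b / a) := by positivity
        rw [h1, Real.log_mul ha.ne' h2.ne']
        linarith [Real.log_le_sub_one_of_pos h2]
      set c := I.countDp s l W
      set d := I.countDp s l (insert i W)
      have hc := ih W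
      have hd := ih (insert i W)
      have hm1 : c ≤ max c (1 + d) := le_max_left _ _
      have hm2 : 1 + d ≤ max c (1 + d) := le_max_right _ _
      have hba1 : b / a ≤ 1 := (div_le_one ha).2 hba
      rcases le_total (b / a) (1 / N) with hr | hr
      · have h3 : p * (b / a) ≤ 1 / N := by
          calc p * (b / a) ≤ 1 * (b / a) := mul_le_mul_of_nonneg_right hp1 (by positivity)
            _ ≤ 1 / N := by linarith
        have h4 : c ≤ (1 - p) * c + p * max c (1 + d) := by
          nlinarith [mul_le_mul_of_nonneg_left hm1 hp0]
        have h5 := mul_le_mul_of_nonneg_left h4 hK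
        have h6 : 2 / N = 2 * (1 / N) := by ring
        linarith
      · have h3 : Real.log a ≤ Real.log N + Real.log b := by
          rw [← Real.log_mul hN0.ne' hb.ne']
          refine Real.log_le_log ha ?_
          rw [div_le_div_iff₀ hN0 ha] at hr
          linarith
        have h4 : p * (b / a) ≤ p := mul_le_of_le_one_right hp0 hba1
        -- The summand 1 in `1 + d` pays for `log N + 2`; the induction hypothesis for `insert i W`
        -- covers `log b`.
        have h5 : Real.log a + 2 ≤ (Real.log N + 2) * max c (1 + d) + 2 * l.length / N := by
          have := mul_le_mul_of_nonneg_left hm2 hK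
          linarith
        have h6 := mul_le_mul_of_nonneg_left h5 hp0
        have h7 := mul_le_mul_of_nonneg_left hc (sub_nonneg.2 hp1)
        linarith
    · rw [add_zero]
      linarith [ih W]

/-- An optimal counting policy is itself an online policy, and every item it counts is worth at
least `s`. Where it prefers to reject, the item is skipped; otherwise it is accepted exactly on
`Set.Ici s`. -/
lemma mul_countDp_le_dp (l : List (Fin n)) : ∀ W,
    (s : ℝ≥0∞) * ENNReal.ofReal (I.countDp s l W) ≤ I.dp l W := by
  induction l with
  | nil => intro W; simp [countDp]
  | cons i l ih =>
    intro W
    have hp0 := I.activeProb_nonneg s i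
    have hp1 := I.activeProb_le_one s i
    have hle := (ih W).trans (I.le_dp_cons i l W)
    rw [countDp]
    split_ifs with h
    · rcases le_total (1 + I.countDp s l (insert i W)) (I.countDp s l W) with hm | hm
      · rw [max_eq_left hm]
        rwa [← add_mul, sub_add_cancel, one_mul]
      · rw [max_eq_right hm]
        refine le_trans ?_ (I.accept_le_dp_cons h (measurableSet_Ici (a := s)))
        have hc := I.countDp_nonneg s l W
        have hd := I.countDp_nonneg s l (insert i W)
        rw [ENNReal.ofReal_add (mul_nonneg (by linarith) hc) (by positivity),
          ENNReal.ofReal_mul (by linarith), ENNReal.ofReal_mul hp0,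
          ENNReal.ofReal_add zero_le_one hd, ENNReal.ofReal_one, ← marg_Ici, ← marg_compl_Ici,
          mul_add]
        refine add_le_add ?_ ?_
        · rw [mul_left_comm]
          gcongr
          exact ih W
        · rw [mul_left_comm, mul_comm, ← setLIntegral_const]
          refine setLIntegral_mono' measurableSet_Ici fun y hy => ?_
          rw [mul_add, mul_one]
          exact add_le_add (ENNReal.coe_le_coe.2 hy) (ih _)
    · exact hle

lemma card_le_maxCount (x : Fin n → ℝ≥0) (l : List (Fin n)) :
    ∀ (W S : Finset (Fin n)), S ⊆ l.toFinset → W ∪ S ∈ I.feasible → (∀ i ∈ S, s ≤ x i) →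
      S.card ≤ I.maxCount s l W x := by
  induction l with
  | nil => intro W S hS _ _; simpa [maxCount] using hS
  | cons i l ih =>
    intro W S hS hF hx
    rw [maxCount]
    by_cases hi : i ∈ S
    · have hsub : insert i W ⊆ W ∪ S := by
        intro j hj
        rcases Finset.mem_insert.1 hj with rfl | hj
        exacts [Finset.mem_union_right _ hi, Finset.mem_union_left _ hj]
      rw [if_pos ⟨hx i hi, I.mem_feasible_of_subset hF hsub⟩,
        ← Finset.card_erase_add_one hi, add_comm]
      refine le_trans (Nat.add_le_add_left (ih (insert i W) (S.erase i) ?_ ?_ ?_) 1)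
        (le_max_right _ _)
      · intro j hj
        have := hS (Finset.mem_of_mem_erase hj)
        rw [List.toFinset_cons, Finset.mem_insert] at this
        exact this.resolve_left (Finset.ne_of_mem_erase hj)
      · rwa [Finset.insert_union, ← Finset.union_insert, Finset.insert_erase hi]
      · exact fun j hj => hx j (Finset.mem_of_mem_erase hj)
    · have h := ih W S (fun j hj => ?_) hF hx
      · split_ifs
        exacts [h.trans (le_max_left _ _), h]
      · have := hS hj
        rw [List.toFinset_cons, Finset.mem_insert] at this
        exact this.resolve_left (ne_of_mem_of_not_mem hj hi)

lemma measurable_maxCount (l : List (Fin n)) : ∀ W, Measurable (I.maxCount s l W) := by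
  classical
  induction l with
  | nil => exact fun W => measurable_const
  | cons i l ih =>
    intro W
    have hc : MeasurableSet {x : Fin n → ℝ≥0 | s ≤ x i ∧ insert i W ∈ I.feasible} :=
      (measurableSet_le measurable_const (measurable_pi_apply i)).inter
        (MeasurableSet.const (insert i W ∈ I.feasible))
    exact Measurable.ite hc ((ih W).max (measurable_const.add (ih _))) (ih W)

lemma measurable_two_pow_maxCount (l : List (Fin n)) (W : Finset (Fin n)) :
    Measurable fun x => (2 : ℝ≥0∞) ^ I.maxCount s l W x :=
  (measurable_of_countable fun k : ℕ => (2 : ℝ≥0∞) ^ k).comp (I.measurable_maxCount s l W)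

/-- Bounding the maximum by a sum, `2 ^ max u (1 + v) ≤ 2 ^ u + 2 * 2 ^ v`, turns the recursion of
`maxCount` into that of `potential`; the second term occurs only when item `i` is active. -/
lemma lmarginal_two_pow_maxCount_le (l : List (Fin n)) (hl : l.Nodup) :
    ∀ (W : Finset (Fin n)) (x : Fin n → ℝ≥0),
      (∫⋯∫⁻_l.toFinset, (fun z => (2 : ℝ≥0∞) ^ I.maxCount s l W z) ∂I.marg) x ≤
        ENNReal.ofReal (I.potential s l W) := by
  induction l with
  | nil => intro W x; simp [maxCount, potential]
  | cons i l ih =>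
    intro W x
    rw [List.nodup_cons] at hl
    have hi : i ∉ l.toFinset := by simpa using hl.1
    rw [List.toFinset_cons, lmarginal_insert _ (I.measurable_two_pow_maxCount s _ _) hi, potential]
    by_cases h : insert i W ∈ I.feasible
    · have key : ∀ y : ℝ≥0, (∫⋯∫⁻_l.toFinset,
          (fun z => (2 : ℝ≥0∞) ^ I.maxCount s (i :: l) W z) ∂I.marg) (Function.update x i y) ≤
          ENNReal.ofReal (I.potential s l W) + (Set.Ici s).indicator
            (fun _ => 2 * ENNReal.ofReal (I.potential s l (insert i W))) y := by
        intro y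
        by_cases hy : s ≤ y
        · rw [Set.indicator_of_mem (by exact hy)]
          have hle : (fun z : Fin n → ℝ≥0 => (2 : ℝ≥0∞) ^ I.maxCount s (i :: l) W z) ≤
              (fun z => (2 : ℝ≥0∞) ^ I.maxCount s l W z) +
                fun z => 2 * (2 : ℝ≥0∞) ^ I.maxCount s l (insert i W) z := by
            intro z
            simp only [maxCount, Pi.add_apply]
            split_ifs
            · rcases max_choice (I.maxCount s l W z) (1 + I.maxCount s l (insert i W) z) with
                h | h <;> rw [h]
              · exact le_self_add
              · rw [pow_add, pow_one]; exact le_add_self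
            · exact le_self_add
          refine (lmarginal_mono hle _).trans ?_
          have hmeas : ∀ V, Measurable fun t : (j : l.toFinset) → ℝ≥0 => (2 : ℝ≥0∞) ^
              I.maxCount s l V (Function.updateFinset (Function.update x i y) l.toFinset t) :=
            fun V => (I.measurable_two_pow_maxCount s l V).comp measurable_updateFinset
          simp only [lmarginal, Pi.add_apply]
          rw [lintegral_add_left (hmeas W), lintegral_const_mul _ (hmeas _)]
          exact add_le_add (ih hl.2 _ _) (mul_le_mul_right (ih hl.2 _ _) _)
        · rw [Set.indicator_of_notMem (by exact hy), add_zero]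
          refine le_trans (le_of_eq ?_) (ih hl.2 W (Function.update x i y))
          simp only [lmarginal, maxCount, Function.updateFinset, hi, dite_false,
            Function.update_self, hy, false_and, if_false]
      refine (lintegral_mono key).trans ?_
      have hp0 := I.activeProb_nonneg s i
      have hb := I.potential_pos s l (insert i W)
      rw [lintegral_add_left measurable_const, lintegral_const, measure_univ, mul_one,
        lintegral_indicator_const measurableSet_Ici, if_pos h,
        ENNReal.ofReal_add (I.potential_pos s l W).le (by positivity),
        ENNReal.ofReal_mul (by positivity), ENNReal.ofReal_mul (by positivity), marg_Ici]
      refine le_of_eq ?_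
      simp only [ENNReal.ofReal_ofNat]
      ring
    · simp only [maxCount, h, and_false, if_false, add_zero]
      refine (lintegral_mono fun y => ih hl.2 W (Function.update x i y)).trans ?_
      simp

lemma lintegral_maxCount_le (hn : 0 < n) :
    ENNReal.ofReal (Real.log 2) *
        ∫⁻ x, (I.maxCount s (List.finRange n) ∅ x : ℝ≥0∞) ∂I.law ≤
      ENNReal.ofReal ((Real.log n + 2) * I.countDp s (List.finRange n) ∅ + 2) := by
  set l := List.finRange n
  set a := I.potential s l ∅
  have ha : 0 < a := I.potential_pos s l ∅
  have hexp : ∫⁻ x, (2 : ℝ≥0∞) ^ I.maxCount s l ∅ x ∂I.law ≤ ENNReal.ofReal a := by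
    have h := I.lmarginal_two_pow_maxCount_le s l (List.nodup_finRange n) ∅ 0
    rwa [List.toFinset_finRange, ← lintegral_eq_lmarginal_univ] at h
  have hlog : Real.log a ≤ (Real.log n + 2) * I.countDp s l ∅ + 2 := by
    have h := I.log_potential_le s (N := n) (by exact_mod_cast hn) l ∅
    rwa [List.length_finRange, mul_div_assoc, div_self (by positivity), mul_one] at h
  refine le_trans ?_ (ENNReal.ofReal_le_ofReal hlog)
  have hlog2 : 0 ≤ Real.log 2 := Real.log_nonneg one_le_two
  have hloga : 0 ≤ Real.log a := Real.log_nonneg (I.one_le_potential s l ∅)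
  -- Jensen's inequality by hand: the tangent of `log` at `a`, evaluated at `2 ^ k`. The 1 stands on
  -- the left to avoid subtraction in `ℝ≥0∞`.
  have hpt : ∀ k : ℕ, ENNReal.ofReal (Real.log 2) * (k : ℝ≥0∞) + 1 ≤
      ENNReal.ofReal (Real.log a) + ENNReal.ofReal a⁻¹ * (2 : ℝ≥0∞) ^ k := by
    intro k
    have h2 : (2 : ℝ≥0∞) ^ k = ENNReal.ofReal ((2 : ℝ) ^ k) := by
      rw [ENNReal.ofReal_pow zero_le_two, ENNReal.ofReal_ofNat]
    rw [h2, ← ENNReal.ofReal_natCast, ← ENNReal.ofReal_one, ← ENNReal.ofReal_mul hlog2,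
      ← ENNReal.ofReal_mul (by positivity), ← ENNReal.ofReal_add (by positivity) zero_le_one,
      ← ENNReal.ofReal_add hloga (by positivity)]
    refine ENNReal.ofReal_le_ofReal ?_
    have h3 := Real.log_le_sub_one_of_pos (show 0 < a⁻¹ * (2 : ℝ) ^ k by positivity)
    rw [Real.log_mul (by positivity) (by positivity), Real.log_inv, Real.log_pow] at h3
    linarith
  have hm : Measurable fun x => (I.maxCount s l ∅ x : ℝ≥0∞) :=
    (measurable_of_countable fun k : ℕ => (k : ℝ≥0∞)).comp (I.measurable_maxCount s l ∅)
  have hprob : IsProbabilityMeasure I.law := by unfold law; infer_instance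
  have hint := lintegral_mono (μ := I.law) fun x => hpt (I.maxCount s l ∅ x)
  rw [lintegral_add_right _ measurable_const, lintegral_const_mul _ hm,
    lintegral_add_left measurable_const,
    lintegral_const_mul _ (I.measurable_two_pow_maxCount s l ∅), lintegral_const, lintegral_const,
    measure_univ, mul_one, mul_one] at hint
  refine ENNReal.le_of_add_le_add_right ENNReal.one_ne_top (hint.trans ?_)
  gcongr
  refine (mul_le_mul_right hexp _).trans (le_of_eq ?_)
  rw [← ENNReal.ofReal_mul (by positivity), inv_mul_cancel₀ ha.ne', ENNReal.ofReal_one]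

/-- Up to a logarithmic factor and an additive error, the optimal online policy collects the
value of the items at level `s` of the offline optimum. -/
lemma mul_lintegral_maxCount_le_dp (hn : 0 < n) :
    ENNReal.ofReal (Real.log 2) *
        (s * ∫⁻ x, (I.maxCount s (List.finRange n) ∅ x : ℝ≥0∞) ∂I.law) ≤
      ENNReal.ofReal (Real.log n + 2) * I.dp (List.finRange n) ∅ + 2 * s := by
  have hK : 0 ≤ Real.log n + 2 := by positivity
  rw [mul_left_comm]
  refine (mul_le_mul_right (I.lintegral_maxCount_le s hn) _).trans ?_
  rw [ENNReal.ofReal_add (mul_nonneg hK (I.countDp_nonneg s _ _)) zero_le_two,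
    ENNReal.ofReal_mul hK, ENNReal.ofReal_ofNat, mul_add, mul_left_comm, mul_comm (s : ℝ≥0∞) 2]
  gcongr
  exact I.mul_countDp_le_dp s _ _

end ProphetInstance

/-! ### Values above the threshold. -/

namespace ProphetInstance

variable {n : ℕ} (I : ProphetInstance n)

/-- The probability that no item of the list is both feasible on its own and of value at
least `T`. -/
noncomputable def probNoneLarge (T : ℝ≥0) (l : List (Fin n)) : ℝ≥0∞ :=
  (l.map fun i => if {i} ∈ I.feasible then I.marg i (Set.Ici T)ᶜ else 1).prod

/-- The expected total value of the items of the list that are feasible on their own and of value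
at least `T`. -/
noncomputable def expectedLarge (T : ℝ≥0) (l : List (Fin n)) : ℝ≥0∞ :=
  (l.map fun i => if {i} ∈ I.feasible then ∫⁻ y in Set.Ici T, (y : ℝ≥0∞) ∂I.marg i else 0).sum

lemma probNoneLarge_le_one (T : ℝ≥0) (l : List (Fin n)) : I.probNoneLarge T l ≤ 1 := by
  induction l with
  | nil => simp [probNoneLarge]
  | cons i l ih =>
    simp only [probNoneLarge, List.map_cons, List.prod_cons] at ih ⊢
    split_ifs
    · exact mul_le_one' prob_le_one ih
    · rwa [one_mul]

/-- Consider accepting the first large feasible singleton. Each item is reached with nothing held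
with probability at least `probNoneLarge`, independently of its own value. -/
lemma probNoneLarge_mul_expectedLarge_le_dp (T : ℝ≥0) (l : List (Fin n)) :
    I.probNoneLarge T l * I.expectedLarge T l ≤ I.dp l ∅ := by
  induction l with
  | nil => simp [expectedLarge]
  | cons i l ih =>
    have hP := I.probNoneLarge_le_one T l
    simp only [probNoneLarge, expectedLarge, List.map_cons, List.prod_cons, List.sum_cons]
      at ih hP ⊢
    split_ifs with h
    · refine le_trans ?_ (I.accept_le_dp_cons (W := ∅) (by simpa using h)
        (measurableSet_Ici (a := T)))
      rw [mul_add, add_comm, mul_assoc]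
      refine add_le_add (mul_le_mul_right ih _) ?_
      calc _ ≤ 1 * ∫⁻ y in Set.Ici T, (y : ℝ≥0∞) ∂I.marg i :=
            mul_le_mul_left (mul_le_one' prob_le_one hP) _
        _ ≤ _ := by
            rw [one_mul]
            exact lintegral_mono fun y => le_self_add
    · rw [one_mul, zero_add]
      exact ih.trans (I.le_dp_cons i l ∅)

/-- The same policy earns at least `T` whenever some large feasible singleton appears. -/
lemma threshold_le_dp_add (T : ℝ≥0) (l : List (Fin n)) :
    (T : ℝ≥0∞) ≤ I.dp l ∅ + T * I.probNoneLarge T l := by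
  induction l with
  | nil => simp [probNoneLarge]
  | cons i l ih =>
    simp only [probNoneLarge, List.map_cons, List.prod_cons] at ih ⊢
    split_ifs with h
    · have hacc := I.accept_le_dp_cons (l := l) (W := ∅) (by simpa using h)
        (measurableSet_Ici (a := T))
      have hT : (T : ℝ≥0∞) * I.marg i (Set.Ici T) ≤
          ∫⁻ y in Set.Ici T, ((y : ℝ≥0∞) + I.dp l (insert i ∅)) ∂I.marg i := by
        rw [← setLIntegral_const]
        exact setLIntegral_mono' measurableSet_Ici fun y hy =>
          (ENNReal.coe_le_coe.2 hy).trans le_self_add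
      set c := I.marg i (Set.Ici T)ᶜ
      set q := I.marg i (Set.Ici T)
      have hcq : q + c = 1 := by
        rw [measure_add_measure_compl measurableSet_Ici, measure_univ]
      set P := (l.map fun i => if {i} ∈ I.feasible then I.marg i (Set.Ici T)ᶜ else 1).prod
      calc (T : ℝ≥0∞) = T * q + c * T := by rw [mul_comm c, ← mul_add, hcq, mul_one]
        _ ≤ T * q + c * (I.dp l ∅ + T * P) := by gcongr
        _ = (c * I.dp l ∅ + T * q) + T * (c * P) := by ring
        _ ≤ I.dp (i :: l) ∅ + T * (c * P) := by
          gcongr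
          exact (add_le_add le_rfl hT).trans hacc
    · rw [one_mul]
      exact ih.trans (add_le_add (I.le_dp_cons i l ∅) le_rfl)

/-- The items above a threshold of at least twice the online value contribute little. -/
lemma expectedLarge_le {T : ℝ≥0} (hT : T ≠ 0) {l : List (Fin n)} (h : 2 * I.dp l ∅ ≤ T) :
    I.expectedLarge T l ≤ 2 * I.dp l ∅ := by
  have h1 := I.threshold_le_dp_add T l
  have h2 := I.probNoneLarge_mul_expectedLarge_le_dp T l
  set P := I.probNoneLarge T l
  -- Doubling `T ≤ J + T * P` and using `2 * J ≤ T` gives `P ≥ 1/2`; cancelling needs `T` finite and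
  -- non-zero.
  have hP : 1 ≤ 2 * P := by
    have h3 : (T : ℝ≥0∞) + T * 1 ≤ T + T * (2 * P) := by
      calc (T : ℝ≥0∞) + T * 1 = 2 * T := by ring
        _ ≤ 2 * (I.dp l ∅ + T * P) := by gcongr
        _ = 2 * I.dp l ∅ + T * (2 * P) := by ring
        _ ≤ _ := by gcongr
    have h4 := ENNReal.le_of_add_le_add_left ENNReal.coe_ne_top h3
    exact (ENNReal.mul_le_mul_iff_right (by simpa using hT) ENNReal.coe_ne_top).1 h4
  calc I.expectedLarge T l = 1 * I.expectedLarge T l := (one_mul _).symm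
    _ ≤ 2 * P * I.expectedLarge T l := by gcongr
    _ = 2 * (P * I.expectedLarge T l) := mul_assoc _ _ _
    _ ≤ _ := by gcongr

/-! ### Dyadic decomposition of the offline optimum. -/

lemma le_sum_dyadic_levels (T x : ℝ≥0) (m : ℕ) :
    x ≤ (if T ≤ x then x else 0) + T / 2 ^ m +
      ∑ j ∈ Finset.range m, 2 * (T / 2 ^ (j + 1)) * (if T / 2 ^ (j + 1) ≤ x then 1 else 0) := by
  induction m with
  | zero =>
    split_ifs with h
    · simp
    · simpa using (not_le.1 h).le
  | succ m ih =>
    rw [Finset.sum_range_succ]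
    by_cases h : T / 2 ^ (m + 1) ≤ x
    · have h2 : 2 * (T / 2 ^ (m + 1)) = T / 2 ^ m := by
        rw [pow_succ]; field_simp
      rw [if_pos h, mul_one, h2]
      refine ih.trans ?_
      rw [add_assoc, add_assoc, add_comm (T / 2 ^ m)]
      exact add_le_add le_rfl le_add_self
    · refine (not_le.1 h).le.trans ?_
      rw [add_assoc, add_left_comm]
      exact le_self_add

lemma offlineValue_le (T : ℝ≥0) {m : ℕ} (hm : I.rank ≤ 2 ^ m) (x : Fin n → ℝ≥0) :
    I.offlineValue x ≤ (∑ i, if {i} ∈ I.feasible ∧ T ≤ x i then x i else 0) + T +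
      ∑ j ∈ Finset.range m, 2 * (T / 2 ^ (j + 1)) *
        I.maxCount (T / 2 ^ (j + 1)) (List.finRange n) ∅ x := by
  refine Finset.sup_le fun S hS => ?_
  refine (Finset.sum_le_sum fun i _ => le_sum_dyadic_levels T (x i) m).trans ?_
  rw [Finset.sum_add_distrib, Finset.sum_add_distrib]
  refine add_le_add (add_le_add ?_ ?_) ?_
  · refine (Finset.sum_le_sum fun i hi => ?_).trans
      (Finset.sum_le_sum_of_subset (Finset.subset_univ S))
    have hiF : {i} ∈ I.feasible :=
      I.mem_feasible_of_subset hS (Finset.singleton_subset_iff.2 hi)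
    simp [hiF]
  -- The remainder `T / 2 ^ m` is paid once per item of `S`, and `S` has at most `2 ^ m` items.
  · rw [Finset.sum_const, nsmul_eq_mul, mul_div_assoc']
    refine div_le_of_le_mul₀ (by positivity) (by positivity) ?_
    rw [mul_comm]
    gcongr
    exact_mod_cast (Finset.le_sup (f := Finset.card) hS).trans hm
  · rw [Finset.sum_comm]
    refine Finset.sum_le_sum fun j _ => ?_
    rw [← Finset.mul_sum, Finset.sum_boole]
    gcongr
    refine I.card_le_maxCount _ x _ ∅ _ (fun i _ => by simp) ?_ fun i hi =>
      (Finset.mem_filter.1 hi).2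
    rw [Finset.empty_union]
    exact I.mem_feasible_of_subset hS (Finset.filter_subset _ _)

lemma lintegral_large (T : ℝ≥0) :
    ∫⁻ x, ((∑ i, if {i} ∈ I.feasible ∧ T ≤ x i then x i else 0 : ℝ≥0) : ℝ≥0∞) ∂I.law =
      I.expectedLarge T (List.finRange n) := by
  have hmeas : ∀ i, Measurable fun y : ℝ≥0 =>
      ((if {i} ∈ I.feasible ∧ T ≤ y then y else 0 : ℝ≥0) : ℝ≥0∞) := fun i => by
    have h : MeasurableSet {y | {i} ∈ I.feasible ∧ T ≤ y} :=
      (MeasurableSet.const (({i} : Finset (Fin n)) ∈ I.feasible)).inter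
        (measurableSet_Ici (a := T))
    exact (Measurable.ite h measurable_id measurable_const).coe_nnreal_ennreal
  simp only [ENNReal.ofNNReal_finsetSum]
  have hmeas' : ∀ i, Measurable fun x : Fin n → ℝ≥0 =>
      ((if {i} ∈ I.feasible ∧ T ≤ x i then x i else 0 : ℝ≥0) : ℝ≥0∞) := fun i =>
    (hmeas i).comp (measurable_pi_apply i)
  rw [lintegral_finsetSum _ fun i _ => hmeas' i, expectedLarge, ← List.ofFn_eq_map, List.sum_ofFn]
  refine Finset.sum_congr rfl fun i _ => ?_
  have hpres : MeasurePreserving (Function.eval i) I.law (I.marg i) :=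
    measurePreserving_eval _ i
  refine (hpres.lintegral_comp (hmeas i)).trans ?_
  split_ifs with h
  · rw [← lintegral_indicator measurableSet_Ici]
    refine lintegral_congr fun y => ?_
    by_cases hy : T ≤ y <;> simp [h, hy]
  · simp [h]

lemma sum_dyadic_le (T : ℝ≥0) (m : ℕ) : ∑ j ∈ Finset.range m, T / 2 ^ (j + 1) ≤ T := by
  suffices h : ∑ j ∈ Finset.range m, T / 2 ^ (j + 1) + T / 2 ^ m = T from
    le_self_add.trans h.le
  induction m with
  | zero => simp
  | succ m ih =>
    rw [Finset.sum_range_succ, add_assoc, ← add_div, ← two_mul, pow_succ',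
      mul_div_mul_left _ _ two_ne_zero, ih]

/-- Of the error `5 * T`, one `T` comes from the small values and `4 * T` from the levels: each has
additive error `2 * s`, doubled by the dyadic rounding, and the levels sum to at most `T`. -/
lemma opt_le_of_threshold (hn : 0 < n) {T : ℝ≥0} (hT : T ≠ 0)
    (h : 2 * I.dp (List.finRange n) ∅ ≤ T) {m : ℕ} (hm : I.rank ≤ 2 ^ m) :
    ENNReal.ofReal (Real.log 2) * I.opt ≤
      ENNReal.ofReal (2 + 2 * m * (Real.log n + 2)) * I.dp (List.finRange n) ∅ + 5 * T := by
  set J := I.dp (List.finRange n) ∅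
  set K := Real.log n + 2
  have hK : 0 ≤ K := by positivity
  have hlog2 : ENNReal.ofReal (Real.log 2) ≤ 1 := by
    rw [← ENNReal.ofReal_one]
    exact ENNReal.ofReal_le_ofReal (by linarith [Real.log_two_lt_d9])
  have hprob : IsProbabilityMeasure I.law := by unfold law; infer_instance
  have hmc : ∀ j : ℕ, Measurable fun x =>
      (I.maxCount (T / 2 ^ (j + 1)) (List.finRange n) ∅ x : ℝ≥0∞) := fun j =>
    (measurable_of_countable fun k : ℕ => (k : ℝ≥0∞)).comp (I.measurable_maxCount _ _ _)
  have hopt : I.opt ≤ I.expectedLarge T (List.finRange n) + T +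
      ∑ j ∈ Finset.range m, 2 * (((T / 2 ^ (j + 1) : ℝ≥0) : ℝ≥0∞) *
        ∫⁻ x, (I.maxCount (T / 2 ^ (j + 1)) (List.finRange n) ∅ x : ℝ≥0∞) ∂I.law) := by
    refine (lintegral_mono fun x => ENNReal.coe_le_coe.2 (I.offlineValue_le T hm x)).trans ?_
    simp only [ENNReal.coe_add, ENNReal.ofNNReal_finsetSum (s := Finset.range m), ENNReal.coe_mul,
      ENNReal.coe_natCast, ENNReal.coe_ofNat]
    have hms : Measurable fun x => ∑ j ∈ Finset.range m, 2 * ((T / 2 ^ (j + 1) : ℝ≥0) : ℝ≥0∞) *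
        (I.maxCount (T / 2 ^ (j + 1)) (List.finRange n) ∅ x : ℝ≥0∞) :=
      Finset.measurable_sum _ fun j _ => (hmc j).const_mul _
    rw [lintegral_add_right _ hms, lintegral_add_right _ measurable_const, lintegral_large,
      lintegral_const, measure_univ, mul_one,
      lintegral_finsetSum _ fun j _ => (hmc j).const_mul _]
    refine add_le_add le_rfl (Finset.sum_le_sum fun j _ => ?_)
    rw [lintegral_const_mul _ (hmc j), mul_assoc]
  have hlevels : ENNReal.ofReal (Real.log 2) *
      ∑ j ∈ Finset.range m, 2 * (((T / 2 ^ (j + 1) : ℝ≥0) : ℝ≥0∞) *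
        ∫⁻ x, (I.maxCount (T / 2 ^ (j + 1)) (List.finRange n) ∅ x : ℝ≥0∞) ∂I.law) ≤
      2 * m * ENNReal.ofReal K * J + 4 * T := by
    rw [Finset.mul_sum]
    calc _ ≤ ∑ j ∈ Finset.range m, (2 * (ENNReal.ofReal K * J) +
            4 * ((T / 2 ^ (j + 1) : ℝ≥0) : ℝ≥0∞)) := by
          refine Finset.sum_le_sum fun j _ => ?_
          rw [mul_left_comm]
          refine (mul_le_mul_right (I.mul_lintegral_maxCount_le_dp _ hn) _).trans (le_of_eq ?_)
          ring
      _ = 2 * m * ENNReal.ofReal K * J +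
            4 * ((∑ j ∈ Finset.range m, T / 2 ^ (j + 1) : ℝ≥0) : ℝ≥0∞) := by
          rw [Finset.sum_add_distrib, Finset.sum_const, Finset.card_range, nsmul_eq_mul,
            ← Finset.mul_sum, ENNReal.ofNNReal_finsetSum]
          ring
      _ ≤ _ := by
          gcongr
          exact sum_dyadic_le T m
  calc _ ≤ ENNReal.ofReal (Real.log 2) * (2 * J + T) + (2 * m * ENNReal.ofReal K * J + 4 * T) := by
        refine (mul_le_mul_right hopt _).trans ?_
        rw [mul_add]
        refine add_le_add (mul_le_mul_right (add_le_add (I.expectedLarge_le hT h) le_rfl) _)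
          hlevels
    _ ≤ 1 * (2 * J + T) + (2 * m * ENNReal.ofReal K * J + 4 * T) := by gcongr
    _ = _ := by
        rw [ENNReal.ofReal_add zero_le_two (by positivity), ENNReal.ofReal_mul (by positivity),
          ENNReal.ofReal_mul zero_le_two, ENNReal.ofReal_natCast, ENNReal.ofReal_ofNat]
        ring

lemma opt_eq_zero_of_rank (h : I.rank = 0) : I.opt = 0 := by
  have hx : ∀ x, I.offlineValue x = 0 := fun x => by
    refine le_antisymm (Finset.sup_le fun S hS => ?_) zero_le
    have hS0 : S.card ≤ 0 := h ▸ Finset.le_sup (f := Finset.card) hS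
    rw [Finset.card_eq_zero.1 (Nat.le_zero.1 hS0), Finset.sum_empty]
  simp [opt, hx]

lemma rank_le : I.rank ≤ n :=
  Finset.sup_le fun S _ => (Finset.card_le_univ S).trans_eq (Fintype.card_fin n)

lemma log_two_mul_opt_le (hn : 0 < n) {m : ℕ} (hm : I.rank ≤ 2 ^ m)
    (hJ : I.dp (List.finRange n) ∅ ≠ ∞) :
    ENNReal.ofReal (Real.log 2) * I.opt ≤
      ENNReal.ofReal (12 + 2 * m * (Real.log n + 2)) * I.dp (List.finRange n) ∅ := by
  obtain ⟨J, hJ⟩ : ∃ J : ℝ≥0, (J : ℝ≥0∞) = I.dp (List.finRange n) ∅ :=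
    ⟨_, ENNReal.coe_toNNReal hJ⟩
  rcases eq_or_ne J 0 with h0 | h0
  -- When `J = 0` the choice `T = 2 * J` is not allowed, but every positive threshold is, so `T`
  -- tends to 0.
  · have hle : ∀ T : ℝ≥0, 0 < T → ENNReal.ofReal (Real.log 2) * I.opt ≤ 0 + T := by
      intro T hT
      have h := I.opt_le_of_threshold hn (T := T / 5) (by positivity)
        (by rw [← hJ, h0]; simp) hm
      rw [← hJ, h0, ENNReal.coe_zero, mul_zero] at h
      convert h using 2
      rw [← ENNReal.coe_ofNat, ← ENNReal.coe_mul, mul_div_cancel₀ _ (by norm_num)]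
    exact (ENNReal.le_of_forall_pos_le_add fun T hT _ => hle T hT).trans zero_le
  -- Here `5 * T = 10 * J`, which raises the constant 2 to 12.
  · have h := I.opt_le_of_threshold hn (T := 2 * J) (by positivity) (by rw [← hJ]; simp) hm
    refine h.trans (le_of_eq ?_)
    rw [← hJ, show (12 : ℝ) + 2 * m * (Real.log n + 2) =
      (2 + 2 * m * (Real.log n + 2)) + 10 by ring,
      ENNReal.ofReal_add (q := 10) (by positivity) (by norm_num), ENNReal.ofReal_ofNat,
      ENNReal.coe_mul, ENNReal.coe_ofNat]
    ring

end ProphetInstance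

/-! ### The numerical constant and the conclusion. -/

lemma ratio_bound {n r : ℕ} (hn : 0 < n) (hr : 0 < r) :
    12 + 2 * ((Nat.log 2 r + 1 : ℕ) : ℝ) * (Real.log n + 2) ≤
      Real.log 2 * (100 * Real.log (n + 1) * Real.log (r + 1)) := by
  have h2 := Real.log_two_gt_d9
  have hn1 : (1 : ℝ) ≤ n := by exact_mod_cast hn
  have hr1 : (1 : ℝ) ≤ r := by exact_mod_cast hr
  have ha : Real.log 2 ≤ Real.log (n + 1) := Real.log_le_log (by norm_num) (by linarith)
  have hb : Real.log 2 ≤ Real.log (r + 1) := Real.log_le_log (by norm_num) (by linarith)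
  have ha' : Real.log n ≤ Real.log (n + 1) := Real.log_le_log (by linarith) (by linarith)
  have hb' : Nat.log 2 r * Real.log 2 ≤ Real.log (r + 1) := by
    rw [← Real.log_pow]
    refine Real.log_le_log (by positivity) ?_
    have : ((2 ^ Nat.log 2 r : ℕ) : ℝ) ≤ r := by exact_mod_cast Nat.pow_log_le_self 2 hr.ne'
    push_cast at this
    linarith
  set a := Real.log (n + 1)
  set b := Real.log (r + 1)
  have hm : ((Nat.log 2 r + 1 : ℕ) : ℝ) ≤ 3 * b := by
    push_cast
    have h0 : (0 : ℝ) ≤ Nat.log 2 r := by positivity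
    nlinarith
  have hK : Real.log n + 2 ≤ 4 * a := by linarith
  have hK0 : 0 ≤ Real.log n + 2 := by positivity
  have hprod : ((Nat.log 2 r + 1 : ℕ) : ℝ) * (Real.log n + 2) ≤ 3 * b * (4 * a) :=
    mul_le_mul hm hK hK0 (by linarith)
  -- This absorbs the constant 12: the left side is at most `12 + 24 * (a * b)`, below `50 * (a *
  -- b)`, while the right side exceeds `69 * (a * b)`.
  have hab : 0.69 * 0.69 ≤ a * b := mul_le_mul (by linarith) (by linarith) (by norm_num)
    (by linarith)
  nlinarith

theorem mainTheorem3 :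
    ∃ C : ℝ, 0 < C ∧ ∃ A : ProphetAlgorithm,
      A.HasCompetitiveRatio fun n r => C * Real.log (n + 1) * Real.log (r + 1) := by
  refine ⟨100, by norm_num, fun n I => I.optimalPolicy, fun n I => ?_⟩
  rw [I.value_optimalPolicy]
  -- At rank 0 the ratio contains `log 1 = 0`, so the optimum itself has to vanish.
  rcases Nat.eq_zero_or_pos I.rank with hr | hr
  · rw [I.opt_eq_zero_of_rank hr]
    exact zero_le
  have hn : 0 < n := hr.trans_le I.rank_le
  have hbound := ratio_bound hn hr
  have hlog2 : 0 < Real.log 2 := Real.log_pos one_lt_two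
  have hρ : 0 < 100 * Real.log (n + 1) * Real.log (I.rank + 1) := by
    have : 0 ≤ 2 * ((Nat.log 2 I.rank + 1 : ℕ) : ℝ) * (Real.log n + 2) := by positivity
    exact pos_of_mul_pos_right (lt_of_lt_of_le (by linarith) hbound) hlog2.le
  -- An infinite online value needs a positive ratio, since `0 * ∞ = 0`; the threshold argument
  -- needs a finite one.
  rcases eq_or_ne (I.dp (List.finRange n) ∅) ∞ with hJ | hJ
  · rw [hJ, ENNReal.mul_top (by simpa using hρ)]
    exact le_top
  · have h := I.log_two_mul_opt_le hn (Nat.lt_pow_succ_log_self one_lt_two I.rank).le hJ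
    have h' := h.trans (mul_le_mul_left (ENNReal.ofReal_le_ofReal hbound) _)
    rw [ENNReal.ofReal_mul hlog2.le, mul_assoc] at h'
    exact (ENNReal.mul_le_mul_iff_right (by simpa using hlog2) ENNReal.ofReal_ne_top).1 h'
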